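/- Let $\mathbb{Z}_3$ be the field with three elements. For a commutative ring $A$ and positive integers $i,j,m,n$, let $$R(A;i,j,m,n)=A\langle x,y : x^iy^m+y^nx^j=1,\ y^{m+n}=0\rangle,$$ that is, the quotient of the free unital associative $A$-algebra on $x,y$ by the two-sided ideal generated by $x^iy^m+y^nx^j-1$ and $y^{m+n}$. Let $\mathcal{A}_A$ be the set of quadruples $(i,j,m,n)$ of positive integers for which there is a non-trivial (i.e. not identically zero) unital $A$-algebra homomorphism $R(A;i,j,m,n)\to M_{m+n}(A)$. Then, for all positive integers $i,j$, we have $(i,j,1,1)\in\mathcal{A}_{\mathbb{Z}_3}$ if and only if at least one of the following holds, where congruences of pairs are taken componentwise: - $(i,j)\equiv(1,1)\pmod 2$; - $(i,j)\equiv(1,2)$, $(2,1)$, $(4,5)$ or $(5,4)\pmod 6$; - $(i,j)\equiv(2,2)$ or $(6,6)\pmod 8$. -/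

import Mathlib

universe u

namespace MatrixRelations

/-- The defining relations `x ^ i * y ^ m + y ^ n * x ^ j = 1` and `y ^ (m + n) = 0` on the free
`A`-algebra on two generators `x` (index `0`) and `y` (index `1`). -/
inductive Rel (A : Type u) [CommRing A] (i j m n : ℕ) :
    FreeAlgebra A (Fin 2) → FreeAlgebra A (Fin 2) → Prop
  | unit : Rel A i j m n
      (FreeAlgebra.ι A 0 ^ i * FreeAlgebra.ι A 1 ^ m + FreeAlgebra.ι A 1 ^ n * FreeAlgebra.ι A 0 ^ j)
      1
  | nilp : Rel A i j m n (FreeAlgebra.ι A 1 ^ (m + n)) 0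

/-- The `A`-algebra `R(A; i, j, m, n) = A⟨x, y : x^i y^m + y^n x^j = 1, y^(m+n) = 0⟩`: the quotient
of the free algebra by the two-sided ideal generated by the defining relations. -/
abbrev R (A : Type u) [CommRing A] (i j m n : ℕ) : Type u :=
  RingQuot (Rel A i j m n)

/-- The set `𝒜_A` of quadruples `(i, j, m, n)` of positive integers for which there is a
non-trivial (that is, not identically zero) unital homomorphism of `A`-algebras from
`R(A; i, j, m, n)` to the ring of `(m + n) × (m + n)` matrices over `A`. -/
def setA (A : Type u) [CommRing A] : Set (ℕ × ℕ × ℕ × ℕ) :=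
  {(i, j, m, n) | 0 < i ∧ 0 < j ∧ 0 < m ∧ 0 < n ∧
    ∃ φ : R A i j m n →ₐ[A] Matrix (Fin (m + n)) (Fin (m + n)) A, ∃ r, φ r ≠ 0}

end MatrixRelations

namespace MatrixRelations

/-! By Cayley–Hamilton, `X ^ i = p X + q` and `X ^ j = r X + s`, with coefficients depending only on
the trace `t` and determinant `d`. When `Y ^ 2 = 0`, `X Y + Y X = t Y + tr(Y X)`, so solvability
reduces to `p = r ≠ 0` and `p t + q + s = 0` (`exists_matrix_iff`). Over `ZMod 3` the coefficients
are eventually periodic in the exponent, leaving a finite check. -/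

/-- The coefficients `(p, q)` with `X ^ k = p • X + q • 1` for every `2 × 2` matrix `X` of trace `t`
and determinant `d`. -/
def powCoeff {K : Type*} [CommRing K] (t d : K) : ℕ → K × K
  | 0 => (0, 1)
  | k + 1 => (t * (powCoeff t d k).1 + (powCoeff t d k).2, -d * (powCoeff t d k).1)

theorem pow_eq_powCoeff {K : Type*} [CommRing K] (X : Matrix (Fin 2) (Fin 2) K) (k : ℕ) :
    X ^ k = (powCoeff X.trace X.det k).1 • X + (powCoeff X.trace X.det k).2 • 1 := by
  induction k with
  | zero => simp [powCoeff]
  | succ k ih =>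
    rw [pow_succ, ih]
    ext a b
    fin_cases a <;> fin_cases b <;>
      simp [powCoeff, Matrix.mul_apply, Fin.sum_univ_two, Matrix.trace_fin_two,
        Matrix.det_fin_two] <;> ring

theorem mem_setA_iff {K : Type*} [CommRing K] {i j m n : ℕ} :
    (i, j, m, n) ∈ setA K ↔ 0 < i ∧ 0 < j ∧ 0 < m ∧ 0 < n ∧
      ∃ X Y : Matrix (Fin (m + n)) (Fin (m + n)) K,
        X ^ i * Y ^ m + Y ^ n * X ^ j = 1 ∧ Y ^ (m + n) = 0 ∧
          (1 : Matrix (Fin (m + n)) (Fin (m + n)) K) ≠ 0 := by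
  refine and_congr_right fun _ => and_congr_right fun _ => and_congr_right fun _ =>
    and_congr_right fun _ => ⟨?_, ?_⟩
  · rintro ⟨φ, r, hr⟩
    have h1 := congrArg φ (RingQuot.mkAlgHom_rel K (Rel.unit (A := K) (i := i) (j := j) (m := m)
      (n := n)))
    have h2 := congrArg φ (RingQuot.mkAlgHom_rel K (Rel.nilp (A := K) (i := i) (j := j) (m := m)
      (n := n)))
    simp only [map_add, map_mul, map_pow, map_one, map_zero] at h1 h2
    refine ⟨_, _, h1, h2, fun h => hr ?_⟩
    rw [← mul_one (φ r), h, mul_zero]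
  · rintro ⟨X, Y, h1, h2, h3⟩
    refine ⟨RingQuot.liftAlgHom K ⟨FreeAlgebra.lift K ![X, Y], ?_⟩, 1, by rwa [map_one]⟩
    rintro _ _ (_ | _)
    · simpa using h1
    · simpa using h2

theorem exists_matrix_iff {K : Type*} [Field K] (i j : ℕ) :
    (∃ X Y : Matrix (Fin 2) (Fin 2) K, X ^ i * Y + Y * X ^ j = 1 ∧ Y ^ 2 = 0) ↔
      ∃ t d : K, (powCoeff t d i).1 = (powCoeff t d j).1 ∧ (powCoeff t d i).1 ≠ 0 ∧
        (powCoeff t d i).1 * t + (powCoeff t d i).2 + (powCoeff t d j).2 = 0 := by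
  constructor
  · rintro ⟨X, Y, h, hY⟩
    refine ⟨X.trace, X.det, ?_⟩
    rw [pow_eq_powCoeff X i, pow_eq_powCoeff X j] at h
    generalize powCoeff X.trace X.det i = u at *
    generalize powCoeff X.trace X.det j = v at *
    obtain ⟨p, q⟩ := u
    obtain ⟨r, s⟩ := v
    dsimp only at h ⊢
    have hY0 : Y ≠ 0 := by
      rintro rfl
      simp at h
    have hnil : IsNilpotent Y := ⟨2, hY⟩
    have htr : Y.trace = 0 := (Matrix.isNilpotent_trace_of_isNilpotent hnil).eq_zero
    have hdet : Y.det = 0 := by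
      have := congrArg Matrix.det hY
      simpa [Matrix.det_pow] using this
    have hYXY : Y * X * Y = (Y * X).trace • Y := by
      rw [Matrix.trace_fin_two] at htr
      rw [Matrix.det_fin_two] at hdet
      ext a b
      fin_cases a <;> fin_cases b <;>
        simp [Matrix.mul_apply, Fin.sum_univ_two, Matrix.trace_fin_two] <;> grind
    have hanti : X * Y + Y * X = X.trace • Y + (Y * X).trace • 1 := by
      rw [Matrix.trace_fin_two] at htr
      ext a b
      fin_cases a <;> fin_cases b <;>
        simp [Matrix.mul_apply, Fin.sum_univ_two, Matrix.trace_fin_two] <;> grind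
    set c := (Y * X).trace
    have hYY : Y * Y = 0 := by rw [← sq, hY]
    have cancel : ∀ a b : K, a • Y = b • Y → a = b := fun a b hab => smul_left_injective K hY0 hab
    -- Multiplying the relation by `Y` on the left kills the second term; on the right, the first.
    have hp : p * c = 1 := by
      refine cancel _ _ ?_
      have := congrArg (fun M => Y * M) h
      simp only [mul_add, add_mul, ← mul_assoc, hYY, zero_mul, mul_one, mul_smul_comm, smul_mul_assoc,
        one_mul, smul_zero, add_zero, hYXY] at this
      rw [mul_smul, this, one_smul]
    have hr : r * c = 1 := by
      refine cancel _ _ ?_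
      have := congrArg (fun M => M * Y) h
      simp only [mul_add, add_mul, mul_assoc, hYY, mul_zero, mul_one, mul_smul_comm,
        smul_mul_assoc, one_mul, smul_zero, add_zero, zero_add] at this
      rw [← mul_assoc, hYXY] at this
      rw [mul_smul, this, one_smul]
    have hc : c ≠ 0 := right_ne_zero_of_mul_eq_one hp
    have hpr : p = r := mul_right_cancel₀ hc (hp.trans hr.symm)
    subst hpr
    refine ⟨rfl, left_ne_zero_of_mul_eq_one hp, cancel _ _ ?_⟩
    have h' : p • (X * Y + Y * X) + (q + s) • Y = 1 := by
      rw [← h]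
      simp only [add_mul, mul_add, smul_mul_assoc, mul_smul_comm, one_mul, mul_one]
      module
    rw [hanti, smul_add, ← mul_smul p c, hp, one_smul] at h'
    rw [zero_smul]
    refine add_eq_right.mp (Eq.trans ?_ h')
    module
  · rintro ⟨t, d, h1, h2, h3⟩
    -- The lower-left entry is `tr(Y X)`, forced to be `p⁻¹`; the upper-right entry then makes the
    -- determinant `d`.
    have htr : (!![0, -d * (powCoeff t d i).1; (powCoeff t d i).1⁻¹, t]).trace = t := by
      simp [Matrix.trace_fin_two]
    have hdet : (!![0, -d * (powCoeff t d i).1; (powCoeff t d i).1⁻¹, t]).det = d := by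
      simp [Matrix.det_fin_two, h2]
    refine ⟨!![0, -d * (powCoeff t d i).1; (powCoeff t d i).1⁻¹, t], !![0, 1; 0, 0], ?_, ?_⟩
    · rw [pow_eq_powCoeff _ i, pow_eq_powCoeff _ j, htr, hdet, ← h1]
      ext a b
      fin_cases a <;> fin_cases b <;> simp [Matrix.mul_apply, Fin.sum_univ_two, Matrix.one_apply, Matrix.vecMul, dotProduct, h2]
      linear_combination h3
    · rw [sq]
      ext a b
      fin_cases a <;> fin_cases b <;> simp

/-- 24 is the exponent of `GL₂(𝔽₃)`. The shift by 2 is needed for nilpotent `X`, where `X ^ 1` may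
be nonzero but `X ^ 25 = 0`; hence exponents 1 and 25 remain separate in `Fin 26` below. -/
theorem powCoeff_add_period (t d : ZMod 3) (k : ℕ) :
    powCoeff t d (k + 2 + 24) = powCoeff t d (k + 2) := by
  induction k with
  | zero =>
    revert t d
    decide +kernel
  | succ k ih =>
    have h : k + 1 + 2 + 24 = (k + 2 + 24) + 1 := by omega
    rw [h, show k + 1 + 2 = k + 2 + 1 by omega, powCoeff, ih, powCoeff.eq_2 t d (k + 2)]

theorem exists_small_exponent (k : ℕ) (hk : 0 < k) :
    ∃ l : Fin 26, 0 < l.val ∧ k % 24 = l.val % 24 ∧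
      ∀ t d : ZMod 3, powCoeff t d k = powCoeff t d l.val := by
  induction k using Nat.strong_induction_on with
  | _ k ih =>
    by_cases hlt : k < 26
    · exact ⟨⟨k, hlt⟩, hk, rfl, fun _ _ => rfl⟩
    · obtain ⟨l, hl, hmod, hpow⟩ := ih (k - 24) (by omega) (by omega)
      refine ⟨l, hl, by omega, fun t d => ?_⟩
      rw [← hpow]
      have h := powCoeff_add_period t d (k - 26)
      rwa [show k - 26 + 2 + 24 = k by omega, show k - 26 + 2 = k - 24 by omega] at h

theorem powCoeff_small_exponent_iff : ∀ a b : Fin 26, 0 < a.val → 0 < b.val →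
    ((∃ t d : ZMod 3, (powCoeff t d a.val).1 = (powCoeff t d b.val).1 ∧
        (powCoeff t d a.val).1 ≠ 0 ∧
        (powCoeff t d a.val).1 * t + (powCoeff t d a.val).2 + (powCoeff t d b.val).2 = 0) ↔
      (a.val % 2 = 1 ∧ b.val % 2 = 1) ∨
      ((a.val % 6 = 1 ∧ b.val % 6 = 2) ∨ (a.val % 6 = 2 ∧ b.val % 6 = 1) ∨
        (a.val % 6 = 4 ∧ b.val % 6 = 5) ∨ (a.val % 6 = 5 ∧ b.val % 6 = 4)) ∨
      ((a.val % 8 = 2 ∧ b.val % 8 = 2) ∨ (a.val % 8 = 6 ∧ b.val % 8 = 6))) := by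
  decide +kernel

end MatrixRelations

theorem corollary3p12 (i j : ℕ) (hi : 0 < i) (hj : 0 < j) :
    (i, j, 1, 1) ∈ MatrixRelations.setA (ZMod 3) ↔
      (i ≡ 1 [MOD 2] ∧ j ≡ 1 [MOD 2]) ∨
      ((i ≡ 1 [MOD 6] ∧ j ≡ 2 [MOD 6]) ∨ (i ≡ 2 [MOD 6] ∧ j ≡ 1 [MOD 6]) ∨
        (i ≡ 4 [MOD 6] ∧ j ≡ 5 [MOD 6]) ∨ (i ≡ 5 [MOD 6] ∧ j ≡ 4 [MOD 6])) ∨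
      ((i ≡ 2 [MOD 8] ∧ j ≡ 2 [MOD 8]) ∨ (i ≡ 6 [MOD 8] ∧ j ≡ 6 [MOD 8])) := by
  have hmem : (i, j, 1, 1) ∈ MatrixRelations.setA (ZMod 3) ↔
      ∃ X Y : Matrix (Fin 2) (Fin 2) (ZMod 3), X ^ i * Y + Y * X ^ j = 1 ∧ Y ^ 2 = 0 := by
    simp [MatrixRelations.mem_setA_iff, hi, hj]
  obtain ⟨a, ha, hia, hpa⟩ := MatrixRelations.exists_small_exponent i hi
  obtain ⟨b, hb, hjb, hpb⟩ := MatrixRelations.exists_small_exponent j hj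
  rw [hmem, MatrixRelations.exists_matrix_iff]
  simp only [hpa, hpb]
  rw [MatrixRelations.powCoeff_small_exponent_iff a b ha hb]
  have h2 : ∀ k l : ℕ, k % 24 = l % 24 → l % 2 = k % 2 ∧ l % 6 = k % 6 ∧ l % 8 = k % 8 := by
    omega
  obtain ⟨ha2, ha6, ha8⟩ := h2 i a hia
  obtain ⟨hb2, hb6, hb8⟩ := h2 j b hjb
  simp only [ha2, ha6, ha8, hb2, hb6, hb8, Nat.ModEq]
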